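/- Let $X$ be a real Banach space with continuous dual $X^*$ and pairing $\langle\cdot,\cdot\rangle$. For a set-valued operator $A\colon X\rightrightarrows X^*$, write $\operatorname{gra}A=\{(x,x^*)\mid x^*\in Ax\}$ and $\operatorname{dom}A=\{x\in X\mid Ax\neq\varnothing\}$; $A$ is *monotone* if $\langle x-y,x^*-y^*\rangle\ge 0$ for all $(x,x^*),(y,y^*)\in\operatorname{gra}A$, and *maximal monotone* if it is monotone and no monotone operator has a graph strictly containing $\operatorname{gra}A$. Let $f\colon X\to\,]-\infty,+\infty]$ be proper (that is, $\operatorname{dom}f:=f^{-1}(\mathbb R)\neq\varnothing$), lower semicontinuous and convex, with subdifferential operator $\partial f(x)=\{x^*\in X^*\mid \langle y-x,x^*\rangle+f(x)\le f(y)\ \text{for all } y\in X\}$, and let $B\colon X\rightrightarrows X^*$ be maximal monotone. Assume that $\operatorname{dom}f\cap\operatorname{int}\operatorname{dom}B\neq\varnothing$ and $\operatorname{dom}\partial f\cap\overline{\operatorname{dom}B}\subseteq\operatorname{dom}B$, where interior and closure are taken in the norm topology. Then the sum $\partial f+B\colon x\mapsto\{a^*+b^*\mid a^*\in\partial f(x),\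 b^*\in Bx\}$ is maximal monotone. -/

import Mathlib

namespace SetValued

/-- A set-valued operator `A : X ⇉ X*` from a real normed space to its continuous dual. -/
abbrev Operator (X : Type*) [NormedAddCommGroup X] [NormedSpace ℝ X] : Type _ :=
  X → Set (StrongDual ℝ X)

section

variable {X : Type*} [NormedAddCommGroup X] [NormedSpace ℝ X]

/-- The graph `{(x, x*) | x* ∈ A x}`. -/
def graph (A : Operator X) : Set (X × StrongDual ℝ X) :=
  {p | p.2 ∈ A p.1}

/-- The domain `{x | A x ≠ ∅}`. -/
def dom (A : Operator X) : Set X :=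
  {x | (A x).Nonempty}

/-- `⟨x - y, x* - y*⟩ ≥ 0` for all `(x, x*)` and `(y, y*)` in the graph of `A`. -/
def IsMonotone (A : Operator X) : Prop :=
  ∀ p ∈ graph A, ∀ q ∈ graph A, 0 ≤ (p.2 - q.2) (p.1 - q.1)

/-- `A` is monotone and has no proper monotone extension, in the sense of graph inclusion. -/
def IsMaximalMonotone (A : Operator X) : Prop :=
  IsMonotone A ∧ ∀ C : Operator X, IsMonotone C → graph A ⊆ graph C → graph C = graph A

/-- The sum `(A + B) x = {a* + b* | a* ∈ A x, b* ∈ B x}`. -/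
def sum (A B : Operator X) : Operator X :=
  fun x => {z | ∃ a ∈ A x, ∃ b ∈ B x, z = a + b}

/-- The effective domain `f⁻¹(ℝ)` of an extended-real-valued function. -/
def effDom (f : X → EReal) : Set X :=
  {x | ∃ r : ℝ, f x = (r : EReal)}

/-- Convexity of an extended-real-valued function. It is used only for functions that do not take
the value `-∞`, so the right-hand side is never of the form `∞ - ∞`. -/
def IsConvex (f : X → EReal) : Prop :=
  ∀ x y : X, ∀ a b : ℝ, 0 < a → 0 < b → a + b = 1 →
    f (a • x + b • y) ≤ (a : EReal) * f x + (b : EReal) * f y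

/-- The subdifferential `∂f x = {x* | ∀ y, ⟨y - x, x*⟩ + f x ≤ f y}`. -/
def subdifferential (f : X → EReal) : Operator X :=
  fun x => {g | ∀ y : X, ((g (y - x) : ℝ) : EReal) + f x ≤ f y}

end

end SetValued

/-!
Write `F_A (x, x*) = sup {⟨x - y, a⟩ + ⟨y, x*⟩ | a ∈ A y}` for the Fitzpatrick function of an
operator `A`. A pair `(z, g)` is monotonically related to the graph of `A` exactly when `F_A (z, g)
≤ ⟨z, g⟩`. The proof has two halves.

*`F_{∂f + B} ≥ ⟨·, ·⟩`* (`exists_sum_apply_sub_nonpos`). Given `(z, g)`, the task is to find `a ∈ ∂f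
y` and `b ∈ B y` with `⟨y - z, a + b - g⟩ ≤ 0`. Let `x₀ ∈ dom f ∩ int dom B`, let `B` be bounded by
`M` near `x₀`, and let `D` be the drop spanned by a small ball around `x₀` and the vertex `z`. By
monotonicity `⟨y - z, b⟩ ≤ M ‖y - z‖` for all `y ∈ D`, `b ∈ B y`
(`IsMonotone.apply_sub_le_of_mem_drop`). Let `C` be the closure of `dom B`, which is convex
(`IsMaximalMonotone.convex_closure_dom`). Ekeland's principle (`exists_forall_le_add_mul_dist`),
applied to `f - g + (M + ρ) ‖· - z‖` on `C ∩ D` with slope `ρ`, gives a point `y`, and the sandwich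
theorem `exists_affine_between` splits the optimality condition there into a subgradient of `f`, a
normal to `C` and a contribution of `D` and the norms. The normal to `C` is absorbed by `B`, and `B
y` is nonempty since `y ∈ dom ∂f ∩ C`. The contribution of `D` has a favourable sign because `z ∈
D`, and the penalty of slope `M` outweighs `⟨y - z, b⟩`.

*From there to maximality.* If `(z, g)` is monotonically related to the graph of `∂f + B`, then
`F_{∂f + B}` touches the duality pairing at `(z, g)` from above, and the first order condition there
says `F_{∂f + B} (x, x*) ≥ ⟨z, x*⟩ + ⟨x, g⟩ - ⟨z, g⟩`. As `F_{∂f + B} (x, α + β)` is at most `f x +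
f* α + F_B (x, β)` and `f` is the supremum of its affine minorants, this becomes `f z ≤ f x - ⟨x -
z, g⟩ + F_B (x, β) - ⟨z, β⟩` for all `x` and `β` (`le_of_monotonicallyRelated_sum`). The right-hand
side, minimized over `β`, is a sum of two convex functions of `x`, the second bounded above near
`x₀`. The sandwich theorem separates them by an affine function, whose slope `b` lies in `B z` with
`g - b ∈ ∂f z` (`IsMaximalMonotone.exists_mem_of_fitzpatrickEpigraph`).
-/

open Set Filter Topology

namespace SetValued

/-! ### Ekeland's variational principle -/

/-- Ekeland's variational principle, stated for a closed set `E ⊆ M × ℝ` in place of the epigraph of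
a lower semicontinuous function: for every slope `σ > 0` some point of `E` is the lowest one after
adding the cone function with that slope centred at it. -/
theorem exists_forall_le_add_mul_dist {M : Type*} [MetricSpace M] [CompleteSpace M]
    {E : Set (M × ℝ)} (hE : IsClosed E) (hne : E.Nonempty) {m : ℝ} (hm : ∀ p ∈ E, m ≤ p.2)
    {σ : ℝ} (hσ : 0 < σ) :
    ∃ p ∈ E, ∀ q ∈ E, p.2 ≤ q.2 + σ * dist q.1 p.1 := by
  -- Points below `p` in the order `q.2 + σ * dist q.1 p.1 ≤ p.2`: the chosen `q` lies at most
  -- halfway between the infimum of their heights and `p.2`. Iterating gives a Cauchy sequence.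
  have step : ∀ p : E, ∃ q : E, q.1.2 + σ * dist q.1.1 p.1.1 ≤ p.1.2 ∧
      ∀ q' ∈ E, q'.2 + σ * dist q'.1 p.1.1 ≤ p.1.2 → 2 * q.1.2 - p.1.2 ≤ q'.2 := by
    intro p
    let V : Set ℝ := {v | ∃ q ∈ E, q.2 + σ * dist q.1 p.1.1 ≤ p.1.2 ∧ v = q.2}
    have hpV : p.1.2 ∈ V := ⟨p.1, p.2, by simp, rfl⟩
    have hV : BddBelow V := ⟨m, by rintro _ ⟨q, hq, -, rfl⟩; exact hm q hq⟩
    rcases (csInf_le hV hpV).eq_or_lt with heq | hlt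
    · refine ⟨p, by simp, fun q' hq' hle => ?_⟩
      have := csInf_le hV ⟨q', hq', hle, rfl⟩
      linarith
    · obtain ⟨_, ⟨q, hq, hle, rfl⟩, hlt'⟩ :=
        exists_lt_of_csInf_lt ⟨_, hpV⟩ (show sInf V < (sInf V + p.1.2) / 2 by linarith)
      refine ⟨⟨q, hq⟩, hle, fun q' hq' hle' => ?_⟩
      have := csInf_le hV ⟨q', hq', hle', rfl⟩
      simp only
      linarith
  choose next hnext hmin using step
  obtain ⟨p₀, hp₀⟩ := hne
  let u : ℕ → E := fun n => next^[n] ⟨p₀, hp₀⟩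
  have hu : ∀ n, u (n + 1) = next (u n) := fun n => Function.iterate_succ_apply' _ _ _
  have hstep : ∀ n, (u (n + 1)).1.2 + σ * dist (u (n + 1)).1.1 (u n).1.1 ≤ (u n).1.2 :=
    fun n => hu n ▸ hnext (u n)
  have hle : ∀ n k, (u (n + k)).1.2 + σ * dist (u (n + k)).1.1 (u n).1.1 ≤ (u n).1.2 := by
    intro n k
    induction k with
    | zero => simp
    | succ k ih =>
      have h1 := hstep (n + k)
      have h2 := mul_le_mul_of_nonneg_left
        (dist_triangle (u (n + k + 1)).1.1 (u (n + k)).1.1 (u n).1.1) hσ.le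
      rw [← add_assoc]
      linarith
  have hanti : Antitone fun n => (u n).1.2 := antitone_nat_of_succ_le fun n => by
    have := mul_nonneg hσ.le (dist_nonneg (x := (u (n + 1)).1.1) (y := (u n).1.1))
    linarith [hstep n]
  have hbdd : BddBelow (range fun n => (u n).1.2) :=
    ⟨m, by rintro _ ⟨n, rfl⟩; exact hm _ (u n).2⟩
  obtain ⟨t, ht⟩ : ∃ t, Tendsto (fun n => (u n).1.2) atTop (𝓝 t) :=
    ⟨_, tendsto_atTop_ciInf hanti hbdd⟩
  have htle : ∀ n, t ≤ (u n).1.2 := hanti.le_of_tendsto ht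
  have hcauchy : CauchySeq fun n => (u n).1.1 := by
    refine cauchySeq_of_le_tendsto_0' (fun n => ((u n).1.2 - t) / σ) ?_ ?_
    · intro n k hnk
      obtain ⟨k, rfl⟩ := Nat.exists_eq_add_of_le hnk
      rw [le_div_iff₀ hσ, dist_comm]
      linarith [hle n k, htle (n + k)]
    · simpa using (ht.sub_const t).div_const σ
  obtain ⟨x, hx⟩ := cauchySeq_tendsto_of_complete hcauchy
  have hxE : (x, t) ∈ E := hE.mem_of_tendsto (hx.prodMk_nhds ht)
    (Eventually.of_forall fun n => (u n).2)
  have hxle : ∀ n, t + σ * dist x (u n).1.1 ≤ (u n).1.2 := by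
    intro n
    have h1 : Tendsto (fun k => (u (k + n)).1.2 + σ * dist (u (k + n)).1.1 (u n).1.1) atTop
        (𝓝 (t + σ * dist x (u n).1.1)) :=
      ((tendsto_add_atTop_iff_nat n).2 ht).add
        ((((tendsto_add_atTop_iff_nat n).2 hx).dist tendsto_const_nhds).const_mul σ)
    exact le_of_tendsto' h1 fun k => add_comm n k ▸ hle n k
  refine ⟨(x, t), hxE, fun q hq => ?_⟩
  by_contra! hlt
  have hq2 : ∀ n, 2 * (u (n + 1)).1.2 - (u n).1.2 ≤ q.2 := by
    intro n
    rw [hu]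
    refine hmin (u n) q hq ?_
    have h2 := mul_le_mul_of_nonneg_left (dist_triangle q.1 x (u n).1.1) hσ.le
    have := hxle n
    simp only at hlt
    linarith
  have hlim : Tendsto (fun n => 2 * (u (n + 1)).1.2 - (u n).1.2) atTop (𝓝 (2 * t - t)) :=
    (((tendsto_add_atTop_iff_nat 1).2 ht).const_mul 2).sub ht
  have := le_of_tendsto' hlim hq2
  have := mul_nonneg hσ.le (dist_nonneg (x := q.1) (y := x))
  simp only at hlt
  linarith

/-! ### Separation of epigraphs -/

/-- Sandwich theorem. With `P` and `Q` the epigraphs of convex functions `φ` and `ψ`, it says that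
`0 ≤ φ + ψ` yields a continuous affine function `ℓ` with `-φ ≤ ℓ ≤ ψ`, provided `ψ` is bounded above
near a point of the domain of `φ`. The sets need neither be closed nor be upward closed. -/
theorem exists_affine_between {X : Type*} [NormedAddCommGroup X] [NormedSpace ℝ X]
    {P Q : Set (X × ℝ)} (hP : Convex ℝ P) (hQ : Convex ℝ Q)
    (hPQ : ∀ x r s, (x, r) ∈ P → (x, s) ∈ Q → 0 ≤ r + s)
    {x₀ : X} {r₀ ε K : ℝ} (hε : 0 < ε) (hx₀ : (x₀, r₀) ∈ P)
    (hball : ∀ x ∈ Metric.ball x₀ ε, (x, K) ∈ Q) :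
    ∃ (u : StrongDual ℝ X) (c : ℝ), (∀ x r, (x, r) ∈ P → -r ≤ u x + c) ∧
      ∀ x s, (x, s) ∈ Q → u x + c ≤ s := by
  -- The strict epigraph of `w ↦ inf {φ x + ψ (x + w)}`; the origin is not in it.
  let T : Set (X × ℝ) := {p | ∃ x r x' s, (x, r) ∈ P ∧ (x', s) ∈ Q ∧ p.1 = x' - x ∧ r + s < p.2}
  have hT : Convex ℝ T := by
    rintro ⟨w₁, t₁⟩ ⟨x₁, r₁, x₁', s₁, hP₁, hQ₁, h₁, h₁'⟩
      ⟨w₂, t₂⟩ ⟨x₂, r₂, x₂', s₂, hP₂, hQ₂, h₂, h₂'⟩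
      a b ha hb hab
    refine ⟨_, _, _, _, hP hP₁ hP₂ ha hb hab, hQ hQ₁ hQ₂ ha hb hab, ?_, ?_⟩
    · simp only at h₁ h₂
      simp only [Prod.fst_add, Prod.smul_fst, h₁, h₂, smul_sub]
      abel
    · simp only at h₁' h₂'
      simp only [smul_eq_mul, Prod.snd_add, Prod.smul_snd]
      rcases ha.eq_or_lt with rfl | ha
      · obtain rfl : b = 1 := by linarith
        linarith
      · nlinarith
  have hint : ∀ τ : ℝ, r₀ + K < τ → ((0 : X), τ) ∈ interior T := by
    intro τ hτ
    refine mem_interior.2 ⟨Metric.ball 0 ε ×ˢ Ioi (r₀ + K), ?_, Metric.isOpen_ball.prod isOpen_Ioi,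
      by simpa using ⟨hε, hτ⟩⟩
    rintro ⟨w, t⟩ ⟨hw, ht⟩
    refine ⟨x₀, r₀, x₀ + w, K, hx₀, hball _ (by simpa using hw), by simp, ht⟩
  have h0 : ((0 : X), (0 : ℝ)) ∉ interior T := by
    intro h
    obtain ⟨x, r, x', s, h₁, h₂, h₃, h₄⟩ := interior_subset h
    obtain rfl : x' = x := (sub_eq_zero.1 h₃.symm)
    exact absurd (hPQ _ _ _ h₁ h₂) (not_le.2 h₄)
  obtain ⟨h, hh⟩ := geometric_hahn_banach_open_point hT.interior isOpen_interior h0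
  have hh0 : h (0, 0) = 0 := map_zero h
  rw [hh0] at hh
  have hle : ∀ p ∈ T, h p ≤ 0 := by
    intro p hp
    have hp' : p ∈ closure (interior T) := by
      rw [hT.closure_interior_eq_closure_of_nonempty_interior ⟨_, hint (r₀ + K + 1) (by linarith)⟩]
      exact subset_closure hp
    exact closure_minimal (fun x hx => (hh x hx).le) (isClosed_Iic.preimage h.continuous) hp'
  have hsplit : ∀ w t, h (w, t) = h (w, 0) + t * h (0, 1) := by
    intro w t
    have : ((w, t) : X × ℝ) = (w, 0) + t • (0, 1) := by simp
    rw [this, map_add, map_smul, smul_eq_mul]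
  have hγ : h (0, 1) < 0 := by
    have h1 := hh _ (hint (|r₀ + K| + 1) (by linarith [le_abs_self (r₀ + K)]))
    rw [hsplit, hh0, zero_add] at h1
    exact neg_of_mul_neg_right h1 (by positivity)
  set γ : ℝ := -h (0, 1) with hγdef
  have hγpos : 0 < γ := by simpa [hγdef] using hγ
  let u : StrongDual ℝ X := γ⁻¹ • (h.comp (ContinuousLinearMap.inl ℝ X ℝ))
  have hu : ∀ w t, h (w, t) = γ * (u w - t) := by
    intro w t
    have : u w = γ⁻¹ * h (w, 0) := rfl
    rw [hsplit, this, mul_sub, mul_inv_cancel_left₀ hγpos.ne']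
    simp only [hγdef]
    ring
  have key : ∀ x r x' s, (x, r) ∈ P → (x', s) ∈ Q → u x' - s ≤ u x + r := by
    intro x r x' s h₁ h₂
    refine le_of_forall_pos_le_add fun η hη => ?_
    have := hle (x' - x, r + s + η) ⟨x, r, x', s, h₁, h₂, rfl, by simpa using hη⟩
    rw [hu] at this
    have := nonpos_of_mul_nonpos_right this hγpos
    rw [map_sub] at this
    linarith
  let S : Set ℝ := {v | ∃ x s, (x, s) ∈ Q ∧ v = u x - s}
  have hS : S.Nonempty := ⟨_, x₀, K, hball _ (Metric.mem_ball_self hε), rfl⟩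
  have hbdd : BddAbove S := ⟨u x₀ + r₀, by rintro _ ⟨x, s, hxs, rfl⟩; exact key _ _ _ _ hx₀ hxs⟩
  refine ⟨u, -sSup S, fun x r hxr => ?_, fun x s hxs => ?_⟩
  · have : sSup S ≤ u x + r := csSup_le hS (by rintro _ ⟨x, s, hxs, rfl⟩; exact key _ _ _ _ hxr hxs)
    linarith
  · have : u x - s ≤ sSup S := le_csSup hbdd ⟨x, s, hxs, rfl⟩
    linarith

/-- The epigraph `{(x, r) | f x ≤ r}` with real heights `r`, so that Hahn–Banach separation takes
place in the normed space `X × ℝ`; it sees exactly the effective domain of `f`. -/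
def epigraph {X : Type*} (f : X → EReal) : Set (X × ℝ) :=
  {p | f p.1 ≤ (p.2 : EReal)}

theorem isClosed_epigraph {X : Type*} [TopologicalSpace X] {f : X → EReal}
    (hf : LowerSemicontinuous f) : IsClosed (epigraph f) :=
  hf.isClosed_epigraph.preimage
    (continuous_fst.prodMk (continuous_coe_real_ereal.comp continuous_snd))

variable {X : Type*} [NormedAddCommGroup X] [NormedSpace ℝ X]

theorem IsConvex.convex_epigraph {f : X → EReal} (hf : IsConvex f) : Convex ℝ (epigraph f) := by
  rintro ⟨x, r⟩ hx ⟨y, s⟩ hy a b ha hb hab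
  rcases ha.eq_or_lt with rfl | ha
  · obtain rfl : b = 1 := by linarith
    simpa using hy
  rcases hb.eq_or_lt with rfl | hb
  · obtain rfl : a = 1 := by linarith
    simpa using hx
  change f (a • x + b • y) ≤ ((a * r + b * s : ℝ) : EReal)
  refine (hf x y a b ha hb hab).trans ?_
  rw [EReal.coe_add, EReal.coe_mul, EReal.coe_mul]
  exact add_le_add (mul_le_mul_of_nonneg_left hx (by exact_mod_cast ha.le))
    (mul_le_mul_of_nonneg_left hy (by exact_mod_cast hb.le))

/-- A proper lower semicontinuous convex function is the supremum of its continuous affine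
minorants. -/
theorem exists_affine_minorant {f : X → EReal} (hne : (effDom f).Nonempty)
    (hlsc : LowerSemicontinuous f) (hconv : IsConvex f) {z : X} {r : ℝ} (hr : (r : EReal) < f z) :
    ∃ (α : StrongDual ℝ X) (κ : ℝ), (∀ p ∈ epigraph f, α p.1 + κ ≤ p.2) ∧ r < α z + κ := by
  have hsep : ∀ (w : X) (ρ : ℝ), (ρ : EReal) < f w → ∃ (β : StrongDual ℝ X) (γ u : ℝ),
      0 ≤ γ ∧ β w + γ * ρ < u ∧ ∀ p ∈ epigraph f, u < β p.1 + γ * p.2 := by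
    intro w ρ hw
    obtain ⟨h, u, h₁, h₂⟩ := geometric_hahn_banach_point_closed hconv.convex_epigraph
      (isClosed_epigraph hlsc) (x := (w, ρ)) (fun h => absurd hw (not_lt.2 h))
    have hsplit : ∀ w t, h (w, t) = h (w, 0) + h (0, 1) * t := by
      intro w t
      have : ((w, t) : X × ℝ) = (w, 0) + t • (0, 1) := by simp
      rw [this, map_add, map_smul, smul_eq_mul, mul_comm]
    refine ⟨h.comp (ContinuousLinearMap.inl ℝ X ℝ), h (0, 1), u, ?_, ?_, ?_⟩
    · by_contra! hneg
      obtain ⟨x, s, hs⟩ := hne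
      obtain ⟨t, ht⟩ : ∃ t : ℝ, h (0, 1) * t ≤ u - h (x, 0) ∧ s ≤ t := by
        refine ⟨max s ((u - h (x, 0)) / h (0, 1)), ?_, le_max_left _ _⟩
        have := mul_le_mul_of_nonpos_left (le_max_right s ((u - h (x, 0)) / h (0, 1))) hneg.le
        rwa [mul_div_cancel₀ _ hneg.ne] at this
      have := h₂ (x, t) (hs.le.trans (EReal.coe_le_coe_iff.2 ht.2))
      rw [hsplit] at this
      linarith
    · have := h₁
      rwa [hsplit] at this
    · intro p hp
      have := h₂ p hp
      rwa [← Prod.mk.eta (p := p), hsplit] at this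
  have hpos : ∀ {w : X} {ρ : ℝ} {β : StrongDual ℝ X} {γ u : ℝ}, 0 < γ → β w + γ * ρ < u →
      (∀ p ∈ epigraph f, u < β p.1 + γ * p.2) → ∃ (α : StrongDual ℝ X) (κ : ℝ),
        (∀ p ∈ epigraph f, α p.1 + κ ≤ p.2) ∧ ρ < α w + κ := by
    intro w ρ β γ u hγ h₁ h₂
    refine ⟨-(γ⁻¹ • β), γ⁻¹ * u, fun p hp => ?_, ?_⟩
    · have := h₂ p hp
      have : -(γ⁻¹ * β p.1) + γ⁻¹ * u ≤ γ⁻¹ * (γ * p.2) := by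
        rw [← mul_neg, ← mul_add]
        exact mul_le_mul_of_nonneg_left (by linarith) (by positivity)
      rwa [inv_mul_cancel_left₀ hγ.ne'] at this
    · have : γ⁻¹ * (γ * ρ) < -(γ⁻¹ * β w) + γ⁻¹ * u := by
        rw [← mul_neg, ← mul_add]
        exact mul_lt_mul_of_pos_left (by linarith) (by positivity)
      rwa [inv_mul_cancel_left₀ hγ.ne'] at this
  obtain ⟨β, γ, u, hγ, h₁, h₂⟩ := hsep z r hr
  rcases hγ.lt_or_eq with hγ | rfl
  · exact hpos hγ h₁ h₂
  -- The separating hyperplane is vertical, which only happens for `f z = ⊤`: a large multiple of it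
  -- is added to a minorant that comes from a non-vertical hyperplane at a point of the domain.
  obtain ⟨x, s, hs⟩ := hne
  obtain ⟨α, κ, hα, -⟩ : ∃ (α : StrongDual ℝ X) (κ : ℝ),
        (∀ p ∈ epigraph f, α p.1 + κ ≤ p.2) ∧ s - 1 < α x + κ := by
    obtain ⟨β', γ', u', hγ', h₁', h₂'⟩ := hsep x (s - 1) (by rw [hs]; exact_mod_cast sub_one_lt s)
    refine hpos ?_ h₁' h₂'
    have := h₂' (x, s) hs.le
    simp only at this
    nlinarith
  simp only [zero_mul, add_zero] at h₁ h₂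
  obtain ⟨N, hN⟩ := exists_nat_gt ((r - (α z + κ)) / (u - β z))
  rw [div_lt_iff₀ (by linarith)] at hN
  refine ⟨α - (N : ℝ) • β, κ + N * u, fun p hp => ?_, ?_⟩
  · have h3 := hα p hp
    have h4 := mul_le_mul_of_nonneg_left (h₂ p hp).le (Nat.cast_nonneg (α := ℝ) N)
    simp only [sub_apply, smul_apply, smul_eq_mul]
    linarith
  · simp only [sub_apply, smul_apply, smul_eq_mul]
    linarith

/-! ### Monotone operators near interior points of the domain -/

theorem IsMaximalMonotone.mem {B : Operator X} (hB : IsMaximalMonotone B) {x : X}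
    {g : StrongDual ℝ X} (h : ∀ y, ∀ b ∈ B y, 0 ≤ (g - b) (x - y)) : g ∈ B x := by
  let C : Operator X := fun y => {b | b ∈ B y ∨ (y, b) = (x, g)}
  have hC : IsMonotone C := by
    rintro ⟨y, b⟩ hy ⟨y', b'⟩ hy'
    rcases hy with hy | hy <;> rcases hy' with hy' | hy'
    · exact hB.1 _ hy _ hy'
    · rw [hy', ← neg_sub x y]
      have := h y b hy
      simp only [sub_apply, map_neg] at this ⊢
      linarith
    · rw [hy]
      exact h y' b' hy'
    · rw [hy, hy']
      simp
  have : (x, g) ∈ graph B := by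
    rw [← hB.2 C hC fun p hp => Or.inl hp]
    exact Or.inr rfl
  exact this

/-- A monotone operator on a Banach space is locally bounded at the interior points of its
domain. -/
theorem IsMonotone.exists_bound [CompleteSpace X] {B : Operator X} (hB : IsMonotone B)
    {x₀ : X} (hx₀ : x₀ ∈ interior (dom B)) :
    ∃ ε > 0, ∃ M : ℝ, 0 ≤ M ∧ Metric.ball x₀ ε ⊆ dom B ∧
      ∀ y ∈ Metric.ball x₀ ε, ∀ b ∈ B y, ‖b‖ ≤ M := by
  obtain ⟨η, hη, hηB⟩ := Metric.mem_nhds_iff.1 (mem_interior_iff_mem_nhds.1 hx₀)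
  -- The sublevel sets of the convex lower semicontinuous function `x ↦ sup {b (x - y)}`, the
  -- supremum over the part of the graph with `‖y - x₀‖ ≤ 1`. By Baire, one of them has an interior
  -- point `p` in the ball, and convexity moves the upper bound from `p` to `x₀`.
  let F : ℝ → Set X := fun n => {x | ∀ y, ‖y - x₀‖ ≤ 1 → ∀ b ∈ B y, b (x - y) ≤ n}
  have hFclosed : ∀ n, IsClosed (F n) := by
    intro n
    simp only [F, ofPred_forall]
    exact isClosed_iInter fun y => isClosed_iInter fun _ => isClosed_iInter fun b =>
      isClosed_iInter fun _ => isClosed_le (by fun_prop) continuous_const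
  have hFmem : ∀ x ∈ Metric.ball x₀ η, ∃ n : ℕ, x ∈ F n := by
    intro x hx
    obtain ⟨g, hg⟩ := hηB hx
    obtain ⟨n, hn⟩ := exists_nat_ge (‖g‖ * (‖x - x₀‖ + 1))
    refine ⟨n, fun y hy b hb => ?_⟩
    have h1 := hB (x, g) hg (y, b) hb
    have h2 : ‖x - y‖ ≤ ‖x - x₀‖ + 1 := by
      rw [show x - y = (x - x₀) - (y - x₀) by abel]
      exact (norm_sub_le _ _).trans (by linarith)
    have h3 : g (x - y) ≤ ‖g‖ * ‖x - y‖ := (le_abs_self _).trans (g.le_opNorm _)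
    have h4 := mul_le_mul_of_nonneg_left h2 (norm_nonneg g)
    simp only [sub_apply] at h1
    linarith
  let G : Option ℕ → Set X := fun o => o.elim (Metric.ball x₀ η)ᶜ fun n => F n
  have hG : Dense (⋃ o, interior (G o)) := by
    refine dense_iUnion_interior_of_closed ?_ ?_
    · rintro (_ | n)
      · exact Metric.isOpen_ball.isClosed_compl
      · exact hFclosed n
    · refine eq_univ_of_forall fun x => ?_
      by_cases hx : x ∈ Metric.ball x₀ η
      · obtain ⟨n, hn⟩ := hFmem x hx
        exact mem_iUnion.2 ⟨some n, hn⟩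
      · exact mem_iUnion.2 ⟨none, hx⟩
  obtain ⟨p, hp, hpη⟩ := hG.exists_mem_open Metric.isOpen_ball ⟨x₀, Metric.mem_ball_self hη⟩
  obtain ⟨o, hp⟩ := mem_iUnion.1 hp
  rcases o with _ | n
  · exact absurd hpη (interior_subset hp)
  obtain ⟨r, hr, hrF⟩ := Metric.mem_nhds_iff.1 (mem_interior_iff_mem_nhds.1 hp)
  have hq : (2 : ℝ) • x₀ - p ∈ Metric.ball x₀ η := by
    rw [Metric.mem_ball, dist_eq_norm, two_smul, show x₀ + x₀ - p - x₀ = x₀ - p by abel,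
      ← dist_eq_norm, dist_comm]
    exact hpη
  obtain ⟨m, hm⟩ := hFmem _ hq
  have hF0 : ∀ x ∈ Metric.ball x₀ (r / 2), x ∈ F ((n + m) / 2) := by
    intro x hx y hy b hb
    have h1 : (2 : ℝ) • x - ((2 : ℝ) • x₀ - p) ∈ F n := by
      refine hrF ?_
      rw [Metric.mem_ball, dist_eq_norm] at hx ⊢
      rw [show (2 : ℝ) • x - ((2 : ℝ) • x₀ - p) - p = (2 : ℝ) • (x - x₀) by rw [smul_sub]; abel,
        norm_smul, Real.norm_two]
      linarith
    have h2 := h1 y hy b hb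
    have h3 := hm y hy b hb
    simp only [map_sub, map_smul, smul_eq_mul] at h2 h3 ⊢
    linarith
  set K : ℝ := (n + m) / 2 with hK
  have hK0 : 0 ≤ K := by positivity
  set δ : ℝ := min (min (r / 4) η) 1
  have hδ : 0 < δ := by positivity
  have hδr : δ ≤ r / 4 := (min_le_left _ _).trans (min_le_left _ _)
  refine ⟨δ, hδ, K / (r / 4), by positivity,
    (Metric.ball_subset_ball ((min_le_left _ _).trans (min_le_right _ _))).trans hηB, ?_⟩
  intro y hy b hb
  rw [Metric.mem_ball, dist_eq_norm] at hy
  have hle : ∀ w ∈ Metric.closedBall (0 : X) (r / 4), ‖b w‖ ≤ K := by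
    have hle' : ∀ w ∈ Metric.closedBall (0 : X) (r / 4), b w ≤ K := by
      intro w hw
      have := hF0 (y + w) ?_ y (hy.le.trans (min_le_right _ _)) b hb
      · simpa using this
      rw [Metric.mem_ball, dist_eq_norm, show y + w - x₀ = (y - x₀) + w by abel]
      rw [mem_closedBall_zero_iff] at hw
      exact (norm_add_le _ _).trans_lt (by linarith)
    intro w hw
    refine abs_le.2 ⟨?_, hle' w hw⟩
    have := hle' (-w) (by simpa using hw)
    rw [map_neg] at this
    linarith
  exact ContinuousLinearMap.opNorm_bound_of_ball_bound (by positivity) K b hle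

/-! ### The Fitzpatrick function with the dual variable minimized out -/

theorem mem_subdifferential_of_epigraph {f : X → EReal} (hbot : ∀ x, f x ≠ ⊥) {y : X} {φ : ℝ}
    (hφ : f y = φ) {a : StrongDual ℝ X} (ha : ∀ p ∈ epigraph f, φ + a (p.1 - y) ≤ p.2) :
    a ∈ subdifferential f y := by
  intro w
  rcases eq_or_ne (f w) ⊤ with htop | htop
  · rw [htop]
    exact le_top
  · lift f w to ℝ using ⟨htop, hbot w⟩ with t ht
    have := ha (w, t) ht.ge
    rw [hφ, ← EReal.coe_add, EReal.coe_le_coe_iff]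
    simp only at this
    linarith

/-- The set of `(x, s)` with `F_B (x, β) - β z ≤ s` for some `β`, where
`F_B (x, β) = sup {b (x - y) + β y | b ∈ B y}` is the Fitzpatrick function of `B`. Up to boundary
points it is the epigraph of the convex function `x ↦ inf {F_B (x, β) - β z}` over all `β`; keeping
`β` existential avoids infima that might be infinite. -/
def fitzpatrickEpigraph (B : Operator X) (z : X) : Set (X × ℝ) :=
  {p | ∃ β : StrongDual ℝ X, ∀ y, ∀ b ∈ B y, b (p.1 - y) + β (y - z) ≤ p.2}

theorem convex_fitzpatrickEpigraph (B : Operator X) (z : X) :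
    Convex ℝ (fitzpatrickEpigraph B z) := by
  rintro ⟨x, r⟩ ⟨β, hβ⟩ ⟨x', r'⟩ ⟨β', hβ'⟩ a a' ha ha' haa
  refine ⟨a • β + a' • β', fun y b hb => ?_⟩
  have h1 := mul_le_mul_of_nonneg_left (hβ y b hb) ha
  have h2 := mul_le_mul_of_nonneg_left (hβ' y b hb) ha'
  have h3 : b y = a * b y + a' * b y := by rw [← add_mul, haa, one_mul]
  simp only [Prod.fst_add, Prod.smul_fst, Prod.snd_add, Prod.smul_snd, smul_eq_mul, map_sub,
    map_add, map_smul, add_apply, smul_apply] at h1 h2 ⊢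
  linarith

theorem mem_fitzpatrickEpigraph_of_le {B : Operator X} {z x : X} {r s : ℝ}
    (h : (x, r) ∈ fitzpatrickEpigraph B z) (hrs : r ≤ s) : (x, s) ∈ fitzpatrickEpigraph B z := by
  obtain ⟨β, hβ⟩ := h
  exact ⟨β, fun y b hb => (hβ y b hb).trans hrs⟩

theorem IsMonotone.mem_fitzpatrickEpigraph {B : Operator X} (hB : IsMonotone B) (z : X) {v : X}
    {g : StrongDual ℝ X} (hg : g ∈ B v) : (v, g (v - z)) ∈ fitzpatrickEpigraph B z := by
  refine ⟨g, fun y b hb => ?_⟩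
  have := hB (v, g) hg (y, b) hb
  simp only [map_sub, sub_apply] at this ⊢
  linarith

theorem IsMonotone.exists_ball_fitzpatrickEpigraph {B : Operator X} (hB : IsMonotone B)
    {x₀ : X} {ε M : ℝ} (hM : 0 ≤ M) (hdom : Metric.ball x₀ ε ⊆ dom B)
    (hbound : ∀ y ∈ Metric.ball x₀ ε, ∀ b ∈ B y, ‖b‖ ≤ M) (z : X) :
    ∃ K, ∀ x ∈ Metric.ball x₀ ε, (x, K) ∈ fitzpatrickEpigraph B z := by
  refine ⟨M * (ε + ‖x₀ - z‖), fun x hx => ?_⟩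
  obtain ⟨g, hg⟩ := hdom hx
  refine mem_fitzpatrickEpigraph_of_le (hB.mem_fitzpatrickEpigraph z hg) ?_
  have h1 : ‖x - z‖ ≤ ε + ‖x₀ - z‖ := by
    rw [show x - z = (x - x₀) + (x₀ - z) by abel]
    rw [Metric.mem_ball, dist_eq_norm] at hx
    exact (norm_add_le _ _).trans (by linarith)
  calc g (x - z) ≤ ‖g‖ * ‖x - z‖ := (le_abs_self _).trans (g.le_opNorm _)
    _ ≤ M * (ε + ‖x₀ - z‖) := mul_le_mul (hbound x hx g hg) h1 (norm_nonneg _) hM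

/-- The inequality `β z ≤ F_B (z, β)`, which holds because `B` is maximal. -/
theorem IsMaximalMonotone.nonneg_of_mem_fitzpatrickEpigraph {B : Operator X}
    (hB : IsMaximalMonotone B) {z : X} {s : ℝ} (h : (z, s) ∈ fitzpatrickEpigraph B z) : 0 ≤ s := by
  obtain ⟨β, hβ⟩ := h
  by_contra! hs
  have hmem : β ∈ B z := hB.mem fun y b hb => by
    have := hβ y b hb
    simp only [map_sub, sub_apply] at this ⊢
    linarith
  have := hβ z β hmem
  simp only [sub_self, map_zero, add_zero] at this
  linarith

/-- If `P` is the epigraph of a convex function `φ` with `φ z ≤ 0`, and `φ` plus the partially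
minimized Fitzpatrick function is nonnegative, then some `b ∈ B z` satisfies
`φ x ≥ -b (x - z)` for all `x`. -/
theorem IsMaximalMonotone.exists_mem_of_fitzpatrickEpigraph {B : Operator X}
    (hB : IsMaximalMonotone B) {z : X} {P : Set (X × ℝ)} (hP : Convex ℝ P) (hz : (z, 0) ∈ P)
    (hPB : ∀ x r s, (x, r) ∈ P → (x, s) ∈ fitzpatrickEpigraph B z → 0 ≤ r + s)
    {x₀ : X} {r₀ ε K : ℝ} (hε : 0 < ε) (hx₀ : (x₀, r₀) ∈ P)
    (hball : ∀ x ∈ Metric.ball x₀ ε, (x, K) ∈ fitzpatrickEpigraph B z) :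
    ∃ b ∈ B z, ∀ x r, (x, r) ∈ P → -b (x - z) ≤ r := by
  obtain ⟨b, c, hbP, hbB⟩ := exists_affine_between hP (convex_fitzpatrickEpigraph B z) hPB hε hx₀
    hball
  have hzc := hbP z 0 hz
  have hb : b ∈ B z := hB.mem fun y g hg => by
    have := hbB _ _ (hB.1.mem_fitzpatrickEpigraph z hg)
    simp only [map_sub, sub_apply] at this ⊢
    linarith
  refine ⟨b, hb, fun x r hxr => ?_⟩
  have h1 := hbP x r hxr
  have h2 := hbB _ _ (hB.1.mem_fitzpatrickEpigraph z hb)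
  simp only [map_sub, sub_self, map_zero] at h2 ⊢
  linarith

/-- If `dom B` has an interior point, then its closure is convex: the open segment from such a point
to any convex combination of points of `dom B` stays in `dom B`. -/
theorem IsMaximalMonotone.convex_closure_dom [CompleteSpace X] {B : Operator X}
    (hB : IsMaximalMonotone B) (hint : (interior (dom B)).Nonempty) :
    Convex ℝ (closure (dom B)) := by
  obtain ⟨x₀, hx₀⟩ := hint
  obtain ⟨ε, hε, M, hM, hdom, hbound⟩ := hB.1.exists_bound hx₀
  have hmem : ∀ y₁ ∈ dom B, ∀ y₂ ∈ dom B, ∀ a b : ℝ, 0 ≤ a → 0 ≤ b → a + b = 1 →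
      a • y₁ + b • y₂ ∈ closure (dom B) := by
    rintro y₁ ⟨g₁, hg₁⟩ y₂ ⟨g₂, hg₂⟩ a b ha hb hab
    set y := a • y₁ + b • y₂ with hy
    have htmem : ∀ t ∈ Ioo (0 : ℝ) 1, (1 - t) • y + t • x₀ ∈ dom B := by
      rintro t ⟨ht0, ht1⟩
      set x := (1 - t) • y + t • x₀ with hx
      obtain ⟨K, hK⟩ := hB.1.exists_ball_fitzpatrickEpigraph hM hdom hbound x
      have hconv := convex_fitzpatrickEpigraph B x
      have hyQ := hconv (hB.1.mem_fitzpatrickEpigraph x hg₁) (hB.1.mem_fitzpatrickEpigraph x hg₂)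
        ha hb hab
      obtain ⟨s, hs⟩ : ∃ s, (y, s) ∈ fitzpatrickEpigraph B x := ⟨_, hyQ⟩
      have hball : ∀ w ∈ Metric.ball x (t * ε),
          (w, (1 - t) * s + t * K) ∈ fitzpatrickEpigraph B x := by
        intro w hw
        have hv : x₀ + t⁻¹ • (w - x) ∈ Metric.ball x₀ ε := by
          rw [Metric.mem_ball, dist_eq_norm] at hw ⊢
          rw [add_sub_cancel_left, norm_smul, Real.norm_of_nonneg (by positivity),
            inv_mul_lt_iff₀ ht0]
          exact hw
        have := hconv hs (hK _ hv) (by linarith : 0 ≤ 1 - t) ht0.le (by ring)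
        have hw' : (1 - t) • y + t • (x₀ + t⁻¹ • (w - x)) = w := by
          rw [smul_add t x₀, smul_inv_smul₀ ht0.ne', ← add_assoc, ← hx]
          abel
        simpa only [Prod.smul_mk, Prod.mk_add_mk, hw', smul_eq_mul] using this
      have hnonneg : ∀ w r s, (w, r) ∈ ({(x, 0)} : Set (X × ℝ)) →
          (w, s) ∈ fitzpatrickEpigraph B x → 0 ≤ r + s := by
        intro w r s hw hs
        simp only [mem_singleton_iff, Prod.mk.injEq] at hw
        obtain ⟨rfl, rfl⟩ := hw
        rw [zero_add]
        exact hB.nonneg_of_mem_fitzpatrickEpigraph hs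
      obtain ⟨g, hg, -⟩ := hB.exists_mem_of_fitzpatrickEpigraph (convex_singleton _) rfl hnonneg
        (mul_pos ht0 hε) rfl hball
      exact ⟨g, hg⟩
    have hlim : Tendsto (fun t : ℝ => (1 - t) • y + t • x₀) (𝓝[>] 0) (𝓝 y) := by
      have : Tendsto (fun t : ℝ => (1 - t) • y + t • x₀) (𝓝 0)
          (𝓝 ((1 - (0 : ℝ)) • y + (0 : ℝ) • x₀)) :=
        Continuous.tendsto (by fun_prop) 0
      simp only [sub_zero, one_smul, zero_smul, add_zero] at this
      exact this.mono_left nhdsWithin_le_nhds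
    exact mem_closure_of_tendsto hlim
      (eventually_of_mem (Ioo_mem_nhdsGT one_pos) htmem)
  intro y₁ hy₁ y₂ hy₂ a b ha hb hab
  have := map_mem_closure₂ (f := fun y₁ y₂ : X => a • y₁ + b • y₂) (by fun_prop) hy₁ hy₂
    (fun y₁ hy₁ y₂ hy₂ => hmem y₁ hy₁ y₂ hy₂ a b ha hb hab)
  rwa [closure_closure] at this

/-! ### Drops -/

/-- The drop with base `closedBall x₀ ε` and vertex `z`, that is, the convex hull of `closedBall x₀
ε ∪ {z}` for `ε ≥ 0`, written as a union of balls centred on the segment from `x₀` to `z`. -/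
def drop (x₀ : X) (ε : ℝ) (z : X) : Set X :=
  {x | ∃ t ∈ Icc (0 : ℝ) 1, ‖x - ((1 - t) • x₀ + t • z)‖ ≤ (1 - t) * ε}

theorem right_mem_drop (x₀ : X) (ε : ℝ) (z : X) : z ∈ drop x₀ ε z :=
  ⟨1, by simp, by simp⟩

theorem closedBall_subset_drop (x₀ : X) (ε : ℝ) (z : X) : Metric.closedBall x₀ ε ⊆ drop x₀ ε z :=
  fun x hx => ⟨0, by simp, by simpa [dist_eq_norm] using hx⟩

theorem convex_drop (x₀ : X) (ε : ℝ) (z : X) : Convex ℝ (drop x₀ ε z) := by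
  rintro x ⟨t, ht, hx⟩ y ⟨s, hs, hy⟩ a b ha hb hab
  refine ⟨a * t + b * s, (convex_Icc (0 : ℝ) 1) ht hs ha hb hab, ?_⟩
  have hb' : b = 1 - a := by linarith
  have hsplit : a • x + b • y - ((1 - (a * t + b * s)) • x₀ + (a * t + b * s) • z) =
      a • (x - ((1 - t) • x₀ + t • z)) + b • (y - ((1 - s) • x₀ + s • z)) := by
    subst hb'
    module
  rw [hsplit]
  refine (norm_add_le _ _).trans ?_
  rw [norm_smul, norm_smul, Real.norm_of_nonneg ha, Real.norm_of_nonneg hb]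
  have h1 := mul_le_mul_of_nonneg_left hx ha
  have h2 := mul_le_mul_of_nonneg_left hy hb
  subst hb'
  linarith

theorem isClosed_drop (x₀ : X) (ε : ℝ) (z : X) : IsClosed (drop x₀ ε z) := by
  let S : Set (Icc (0 : ℝ) 1 × X) :=
    {p | ‖p.2 - ((1 - (p.1 : ℝ)) • x₀ + (p.1 : ℝ) • z)‖ ≤ (1 - (p.1 : ℝ)) * ε}
  have hS : IsClosed S := isClosed_le (by fun_prop) (by fun_prop)
  have : drop x₀ ε z = Prod.snd '' S := by
    ext x
    constructor
    · rintro ⟨t, ht, hx⟩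
      exact ⟨(⟨t, ht⟩, x), hx, rfl⟩
    · rintro ⟨⟨⟨t, ht⟩, x⟩, hx, rfl⟩
      exact ⟨t, ht, hx⟩
  rw [this]
  exact isClosedMap_snd_of_compactSpace _ hS

/-- A bound for `B` on the base of the drop controls `b (y - z)` on the whole drop, although `B` may
be unbounded there: `y` lies between `z` and a point `c` of the base, and monotonicity along the
segment compares `b` with an element of `B c`. -/
theorem IsMonotone.apply_sub_le_of_mem_drop {B : Operator X} (hB : IsMonotone B)
    {x₀ : X} {ε M : ℝ} (hdom : Metric.closedBall x₀ ε ⊆ dom B)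
    (hbound : ∀ y ∈ Metric.closedBall x₀ ε, ∀ b ∈ B y, ‖b‖ ≤ M) {z y : X}
    (hy : y ∈ drop x₀ ε z) {b : StrongDual ℝ X} (hb : b ∈ B y) : b (y - z) ≤ M * ‖y - z‖ := by
  have hle : ∀ c ∈ Metric.closedBall x₀ ε, ∀ g ∈ B c, g (c - z) ≤ M * ‖c - z‖ :=
    fun c hc g hg => ((le_abs_self _).trans (g.le_opNorm _)).trans
      (mul_le_mul_of_nonneg_right (hbound c hc g hg) (norm_nonneg _))
  obtain ⟨t, ⟨ht0, ht1⟩, hyt⟩ := hy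
  rcases ht1.eq_or_lt with rfl | ht1
  · obtain rfl : y = z := by simpa [sub_eq_zero] using hyt
    simp
  have ht1' : 0 < 1 - t := by linarith
  obtain ⟨c, hc⟩ : ∃ c, y = (1 - t) • c + t • z :=
    ⟨(1 - t)⁻¹ • (y - t • z), by rw [smul_inv_smul₀ ht1'.ne']; abel⟩
  have hcball : c ∈ Metric.closedBall x₀ ε := by
    rw [show y - ((1 - t) • x₀ + t • z) = (1 - t) • (c - x₀) by rw [hc]; module, norm_smul,
      Real.norm_of_nonneg ht1'.le] at hyt
    rw [Metric.mem_closedBall, dist_eq_norm]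
    exact le_of_mul_le_mul_left hyt ht1'
  have hyz : y - z = (1 - t) • (c - z) := by rw [hc]; module
  rcases ht0.eq_or_lt with rfl | ht0
  · obtain rfl : y = c := by simpa using hc
    exact hle y hcball b hb
  obtain ⟨g, hg⟩ := hdom hcball
  have hmono := hB (c, g) hg (y, b) hb
  rw [show (c, g).1 - (y, b).1 = t • (c - z) by simp only [hc]; module, map_smul, smul_eq_mul]
    at hmono
  have h1 := nonneg_of_mul_nonneg_right hmono ht0
  have h2 := hle c hcball g hg
  rw [hyz, map_smul, smul_eq_mul, norm_smul, Real.norm_of_nonneg ht1'.le]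
  simp only [sub_apply] at h1
  calc (1 - t) * b (c - z) ≤ (1 - t) * (M * ‖c - z‖) :=
        mul_le_mul_of_nonneg_left (by linarith) ht1'.le
    _ = M * ((1 - t) * ‖c - z‖) := by ring

/-! ### Subgradients of restricted functions -/

theorem exists_eq_coe_of_mem_subdifferential {f : X → EReal} (hbot : ∀ x, f x ≠ ⊥) {x : X} {r : ℝ}
    (hr : (x, r) ∈ epigraph f) {y : X} {a : StrongDual ℝ X} (ha : a ∈ subdifferential f y) :
    ∃ φ : ℝ, f y = φ := by
  refine ⟨(f y).toReal, (EReal.coe_toReal (fun htop => ?_) (hbot y)).symm⟩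
  have : ((a (x - y) : ℝ) : EReal) + f y ≤ (r : EReal) := (ha x).trans hr
  rw [htop, EReal.coe_add_top] at this
  exact EReal.coe_ne_top r (top_le_iff.1 this)

theorem isMonotone_sum_subdifferential {f : X → EReal} (hbot : ∀ x, f x ≠ ⊥)
    (hne : (effDom f).Nonempty) {B : Operator X} (hB : IsMonotone B) :
    IsMonotone (sum (subdifferential f) B) := by
  obtain ⟨x₀, r₀, hr₀⟩ := hne
  rintro ⟨x, _⟩ ⟨a, ha, b, hb, rfl⟩ ⟨y, _⟩ ⟨a', ha', b', hb', rfl⟩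
  obtain ⟨φ, hφ⟩ := exists_eq_coe_of_mem_subdifferential hbot (x := x₀) hr₀.le ha
  obtain ⟨ψ, hψ⟩ := exists_eq_coe_of_mem_subdifferential hbot (x := x₀) hr₀.le ha'
  have h1 := ha y
  have h2 := ha' x
  rw [hφ, hψ, ← EReal.coe_add, EReal.coe_le_coe_iff] at h1 h2
  have h3 := hB (x, b) hb (y, b') hb'
  simp only [sub_apply, add_apply, map_sub] at h1 h2 h3 ⊢
  linarith

/-- A subgradient `g` at `y` of `f` restricted to `C` is the sum of a subgradient `a` of `f` and a
normal `g - a` to `C`, if `dom f` meets the interior of `C`. -/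
theorem exists_subdifferential_normal {f : X → EReal} (hbot : ∀ x, f x ≠ ⊥) (hconv : IsConvex f)
    {C : Set X} (hC : Convex ℝ C) {x₀ : X} {r₀ ε : ℝ} (hε : 0 < ε) (hx₀ : (x₀, r₀) ∈ epigraph f)
    (hball : Metric.ball x₀ ε ⊆ C) {y : X} (hy : y ∈ C) {φ : ℝ} (hφ : f y = φ)
    {g : StrongDual ℝ X} (hg : ∀ p ∈ epigraph f, p.1 ∈ C → φ + g (p.1 - y) ≤ p.2) :
    ∃ a ∈ subdifferential f y, ∀ x ∈ C, (g - a) (x - y) ≤ 0 := by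
  have hQ : Convex ℝ {p : X × ℝ | p.1 ∈ C ∧ -φ - g (p.1 - y) ≤ p.2} := by
    rintro ⟨x, r⟩ ⟨hx, hr⟩ ⟨x', r'⟩ ⟨hx', hr'⟩ a b ha hb hab
    refine ⟨hC hx hx' ha hb hab, ?_⟩
    have h1 := mul_le_mul_of_nonneg_left hr ha
    have h2 := mul_le_mul_of_nonneg_left hr' hb
    obtain rfl : b = 1 - a := by linarith
    simp only [Prod.fst_add, Prod.smul_fst, Prod.snd_add, Prod.smul_snd, smul_eq_mul, map_sub,
      map_add, map_smul] at h1 h2 ⊢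
    linarith
  have hnonneg : ∀ x r s, (x, r) ∈ epigraph f →
      (x, s) ∈ {p : X × ℝ | p.1 ∈ C ∧ -φ - g (p.1 - y) ≤ p.2} → 0 ≤ r + s := by
    rintro x r s hr ⟨hx, hs⟩
    have := hg _ hr hx
    simp only at this hs
    linarith
  have hK : ∀ x ∈ Metric.ball x₀ ε, (x, -φ + ‖g‖ * (ε + ‖x₀ - y‖)) ∈
      {p : X × ℝ | p.1 ∈ C ∧ -φ - g (p.1 - y) ≤ p.2} := by
    intro x hx
    refine ⟨hball hx, ?_⟩
    have h1 : ‖x - y‖ ≤ ε + ‖x₀ - y‖ := by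
      rw [show x - y = (x - x₀) + (x₀ - y) by abel]
      rw [Metric.mem_ball, dist_eq_norm] at hx
      exact (norm_add_le _ _).trans (by linarith)
    have h2 := (abs_le.1 (g.le_opNorm (x - y))).1
    have h3 := mul_le_mul_of_nonneg_left h1 (norm_nonneg g)
    simp only
    linarith
  obtain ⟨u, c, hP, hQ⟩ := exists_affine_between hconv.convex_epigraph hQ hnonneg hε hx₀ hK
  have h1 := hP y φ hφ.le
  have h2 := hQ y (-φ) ⟨hy, by simp⟩
  refine ⟨-u, mem_subdifferential_of_epigraph hbot hφ fun p hp => ?_, fun x hx => ?_⟩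
  · have := hP p.1 p.2 hp
    simp only [neg_apply, map_sub] at this ⊢
    linarith
  · have := hQ x (-φ - g (x - y)) ⟨hx, le_rfl⟩
    simp only [neg_apply, sub_apply, map_sub] at this ⊢
    linarith

/-- If `y` minimizes `f + h` over `C ∩ D`, then some `g` is a subgradient at `y` of `f` restricted
to `C` while `-g` is one of `h` restricted to `D`. -/
theorem exists_separating_slope {f : X → EReal} (hconv : IsConvex f) {C D : Set X}
    (hC : Convex ℝ C) (hD : Convex ℝ D) {x₀ : X} {r₀ ε : ℝ} (hε : 0 < ε)
    (hx₀ : (x₀, r₀) ∈ epigraph f) (hx₀C : x₀ ∈ C) (hball : Metric.ball x₀ ε ⊆ D)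
    {h : X → ℝ} (hh : ConvexOn ℝ univ h) {K : ℝ} (hK : ∀ x ∈ Metric.ball x₀ ε, h x ≤ K)
    {y : X} (hyC : y ∈ C) (hyD : y ∈ D) {φ : ℝ} (hφ : f y = φ)
    (hmin : ∀ p ∈ epigraph f, p.1 ∈ C → p.1 ∈ D → φ + h y ≤ p.2 + h p.1) :
    ∃ g : StrongDual ℝ X, (∀ p ∈ epigraph f, p.1 ∈ C → φ + g (p.1 - y) ≤ p.2) ∧
      ∀ x ∈ D, h y - g (x - y) ≤ h x := by
  have hP : Convex ℝ {p : X × ℝ | p ∈ epigraph f ∧ p.1 ∈ C} :=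
    hconv.convex_epigraph.inter (hC.linear_preimage (LinearMap.fst ℝ X ℝ))
  have hQ : Convex ℝ {p : X × ℝ | p.1 ∈ D ∧ h p.1 - (φ + h y) ≤ p.2} := by
    have := ((hh.subset (subset_univ D) hD).add_const (-(φ + h y))).convex_epigraph
    simpa only [Pi.add_apply, ← sub_eq_add_neg] using this
  have hnonneg : ∀ x r s, (x, r) ∈ {p : X × ℝ | p ∈ epigraph f ∧ p.1 ∈ C} →
      (x, s) ∈ {p : X × ℝ | p.1 ∈ D ∧ h p.1 - (φ + h y) ≤ p.2} → 0 ≤ r + s := by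
    rintro x r s ⟨hr, hxC⟩ ⟨hxD, hs⟩
    have := hmin _ hr hxC hxD
    simp only at this hs
    linarith
  obtain ⟨u, c, hP, hQ⟩ := exists_affine_between hP hQ hnonneg hε ⟨hx₀, hx₀C⟩
    fun x hx => ⟨hball hx, sub_le_sub_right (hK x hx) _⟩
  have h1 := hP y φ ⟨hφ.le, hyC⟩
  have h2 := hQ y (-φ) ⟨hyD, by simp⟩
  refine ⟨-u, fun p hp hpC => ?_, fun x hx => ?_⟩
  · have := hP p.1 p.2 ⟨hp, hpC⟩
    simp only [neg_apply, map_sub] at this ⊢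
    linarith
  · have := hQ x (h x - (φ + h y)) ⟨hx, le_rfl⟩
    simp only [neg_apply, map_sub] at this ⊢
    linarith

/-- The values of a maximal monotone operator absorb the normals to the closure of its domain. -/
theorem IsMaximalMonotone.add_normal_mem {B : Operator X} (hB : IsMaximalMonotone B) {y : X}
    {b n : StrongDual ℝ X} (hb : b ∈ B y) (hn : ∀ x ∈ closure (dom B), n (x - y) ≤ 0) :
    b + n ∈ B y := by
  refine hB.mem fun x g hg => ?_
  have h1 := hB.1 (y, b) hb (x, g) hg
  have h2 := hn x (subset_closure ⟨g, hg⟩)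
  simp only [sub_apply, add_apply, map_sub] at h1 h2 ⊢
  linarith

/-! ### Maximality of the sum -/

/-- No pair `(z, g)` is strictly monotonically related to the graph of `∂f + B`; equivalently, the
Fitzpatrick function of `∂f + B` is at least the duality pairing. -/
theorem exists_sum_apply_sub_nonpos [CompleteSpace X] {f : X → EReal} (hbot : ∀ x, f x ≠ ⊥)
    (hlsc : LowerSemicontinuous f) (hconv : IsConvex f) {B : Operator X}
    (hB : IsMaximalMonotone B) (hfB : (effDom f ∩ interior (dom B)).Nonempty)
    (hdom : dom (subdifferential f) ∩ closure (dom B) ⊆ dom B) (z : X) (g : StrongDual ℝ X) :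
    ∃ y, ∃ a ∈ subdifferential f y, ∃ b ∈ B y, (a + b - g) (y - z) ≤ 0 := by
  obtain ⟨x₀, ⟨r₀, hr₀⟩, hx₀⟩ := hfB
  obtain ⟨ε', hε', M, hM, hball', hbound'⟩ := hB.1.exists_bound hx₀
  set ε := ε' / 2
  have hε : 0 < ε := by positivity
  have hsub : Metric.closedBall x₀ ε ⊆ Metric.ball x₀ ε' :=
    Metric.closedBall_subset_ball (half_lt_self hε')
  set C := closure (dom B)
  set D := drop x₀ ε z
  have hC : Convex ℝ C := hB.convex_closure_dom ⟨x₀, hx₀⟩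
  have hballC : Metric.ball x₀ ε ⊆ C :=
    (Metric.ball_subset_closedBall.trans (hsub.trans hball')).trans subset_closure
  have hballD : Metric.ball x₀ ε ⊆ D :=
    Metric.ball_subset_closedBall.trans (closedBall_subset_drop x₀ ε z)
  have hx₀C : x₀ ∈ C := hballC (Metric.mem_ball_self hε)
  have hx₀D : x₀ ∈ D := hballD (Metric.mem_ball_self hε)
  obtain ⟨α, κ, hα, -⟩ := exists_affine_minorant ⟨x₀, r₀, hr₀⟩ hlsc hconv
    (show ((r₀ - 1 : ℝ) : EReal) < f x₀ by rw [hr₀]; exact_mod_cast sub_one_lt r₀)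
  -- The slope `M` pays for `B` on the drop, and `ρ` makes the penalized function bounded below. The
  -- same `ρ` serves as the slope in Ekeland's principle, where it cancels.
  set ρ := ‖α - g‖ + 1
  have hρ : 0 < ρ := by positivity
  let q : X → ℝ := fun x => (M + ρ) * ‖x - z‖ - g x
  have hq : Continuous q := by fun_prop
  let E : Set (X × ℝ) := {p | (p.1, p.2 - q p.1) ∈ epigraph f ∧ p.1 ∈ C ∩ D}
  have hE : IsClosed E :=
    ((isClosed_epigraph hlsc).preimage (by fun_prop)).inter
      ((isClosed_closure.inter (isClosed_drop x₀ ε z)).preimage continuous_fst)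
  have hmem : ∀ p ∈ epigraph f, p.1 ∈ C → p.1 ∈ D → (p.1, p.2 + q p.1) ∈ E := by
    intro p hp hpC hpD
    exact ⟨by simpa using hp, hpC, hpD⟩
  have hlow : ∀ p ∈ E, (α - g) z + κ ≤ p.2 := by
    rintro p ⟨hp, -⟩
    have h1 := hα _ hp
    have h2 := (abs_le.1 ((α - g).le_opNorm (p.1 - z))).1
    have h3 := mul_nonneg hM (norm_nonneg (p.1 - z))
    have h4 := norm_nonneg (p.1 - z)
    simp only [q, ρ, sub_apply, map_sub] at h1 h2 ⊢
    nlinarith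
  obtain ⟨⟨y, m⟩, ⟨hym, hyC, hyD⟩, hmin⟩ := exists_forall_le_add_mul_dist hE
    ⟨_, hmem (x₀, r₀) hr₀.le hx₀C hx₀D⟩ hlow hρ
  simp only at hym hyC hyD hmin
  have hytop : f y ≠ ⊤ := ne_top_of_le_ne_top (EReal.coe_ne_top _) hym
  obtain ⟨φ, hφ⟩ : ∃ φ : ℝ, f y = φ := ⟨(f y).toReal, (EReal.coe_toReal hytop (hbot y)).symm⟩
  have hφm : φ ≤ m - q y := by
    have : f y ≤ ((m - q y : ℝ) : EReal) := hym
    rwa [hφ, EReal.coe_le_coe_iff] at this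
  let h : X → ℝ := fun x => q x + ρ * dist x y
  have hh : ConvexOn ℝ univ h := by
    have h1 : ConvexOn ℝ univ fun x : X => dist x z := convexOn_univ_dist z
    have h2 : ConvexOn ℝ univ fun x : X => dist x y := convexOn_univ_dist y
    have h3 := (-g).toLinearMap.convexOn (convex_univ (𝕜 := ℝ))
    have := ((h1.smul (by positivity : 0 ≤ M + ρ)).add h3).add (h2.smul hρ.le)
    refine this.congr fun x _ => ?_
    simp [h, q, dist_eq_norm, sub_eq_add_neg]
  obtain ⟨K, δ, hδ, hK⟩ : ∃ K, ∃ δ > 0, ∀ x ∈ Metric.ball x₀ δ, h x ≤ K := by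
    have hcont : Continuous h := by fun_prop
    obtain ⟨δ, hδ, hK⟩ := Metric.mem_nhds_iff.1
      (hcont.continuousAt.preimage_mem_nhds (Iio_mem_nhds (lt_add_one (h x₀))))
    exact ⟨_, δ, hδ, fun x hx => (hK hx).le⟩
  obtain ⟨g', hg'C, hg'D⟩ := exists_separating_slope hconv hC (convex_drop x₀ ε z)
    (lt_min hε hδ) (show (x₀, r₀) ∈ epigraph f from hr₀.le) hx₀C
    ((Metric.ball_subset_ball (min_le_left _ _)).trans hballD) hh
    (fun x hx => hK x (Metric.ball_subset_ball (min_le_right _ _) hx)) hyC hyD hφ (by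
      intro p hp hpC hpD
      have := hmin _ (hmem p hp hpC hpD)
      simp only [h, dist_self] at this ⊢
      linarith)
  obtain ⟨a, ha, hn⟩ := exists_subdifferential_normal hbot hconv hC hε
    (show (x₀, r₀) ∈ epigraph f from hr₀.le) hballC hyC hφ hg'C
  obtain ⟨b, hb⟩ := hdom ⟨⟨a, ha⟩, hyC⟩
  refine ⟨y, a, ha, b + (g' - a), hB.add_normal_mem hb hn, ?_⟩
  have h1 := hg'D z (right_mem_drop x₀ ε z)
  have h2 := hB.1.apply_sub_le_of_mem_drop (hsub.trans hball')
    (fun w hw => hbound' w (hsub hw)) hyD hb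
  simp only [h, q, sub_self, norm_zero, dist_eq_norm, norm_sub_rev z y, map_sub,
    sub_apply, add_apply] at h1 h2 ⊢
  linarith

/-- If `(z, g)` is monotonically related to the graph of `∂f + B`, then the function `x ↦ f x - g x
+ inf {F_B (x, β) - β z}`, with the infimum over `β`, is at least `f z - g z`. This is the first
order condition at `(z, g)` for the Fitzpatrick function of `∂f + B`, which lies above the duality
pairing and touches it at `(z, g)`. -/
theorem le_of_monotonicallyRelated_sum [CompleteSpace X] {f : X → EReal} (hbot : ∀ x, f x ≠ ⊥)
    (hlsc : LowerSemicontinuous f) (hconv : IsConvex f) {B : Operator X}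
    (hB : IsMaximalMonotone B) (hfB : (effDom f ∩ interior (dom B)).Nonempty)
    (hdom : dom (subdifferential f) ∩ closure (dom B) ⊆ dom B) {z : X} {g : StrongDual ℝ X}
    (hzg : ∀ y, ∀ a ∈ subdifferential f y, ∀ b ∈ B y, 0 ≤ (g - (a + b)) (z - y))
    {x : X} {r s : ℝ} (hr : (x, r) ∈ epigraph f) (hs : (x, s) ∈ fitzpatrickEpigraph B z) :
    f z ≤ ((r + s - g (x - z) : ℝ) : EReal) := by
  by_contra! hlt
  obtain ⟨α, κ, hα, hακ⟩ := exists_affine_minorant (by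
    obtain ⟨x₀, h, -⟩ := hfB
    exact ⟨x₀, h⟩) hlsc hconv hlt
  obtain ⟨β, hβ⟩ := hs
  have hkey : ∀ t ∈ Ioo (0 : ℝ) 1,
      (α + β - g) z + g x + t * (α + β - g) (x - z) ≤ r + s - κ + β z := by
    rintro t ⟨ht0, ht1⟩
    obtain ⟨y, a, ha, b, hb, hab⟩ := exists_sum_apply_sub_nonpos hbot hlsc hconv hB hfB hdom
      ((1 - t) • z + t • x) ((1 - t) • g + t • (α + β))
    obtain ⟨φ, hφ⟩ := exists_eq_coe_of_mem_subdifferential hbot hr ha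
    have h1 := hα (y, φ) hφ.le
    have h2 : a (x - y) + φ ≤ r := by
      have := (ha x).trans hr
      rwa [hφ, ← EReal.coe_add, EReal.coe_le_coe_iff] at this
    have h3 := hβ y b hb
    have h4 := hzg y a ha b hb
    simp only [sub_apply, add_apply, smul_apply, map_sub, map_add, map_smul, smul_eq_mul]
      at h1 h2 h3 h4 hab ⊢
    -- `hab` minus `(1 - t)` times `h4` is divisible by `t`.
    refine le_of_mul_le_mul_left ?_ ht0
    nlinarith
  have hlim : Tendsto (fun t : ℝ => (α + β - g) z + g x + t * (α + β - g) (x - z)) (𝓝[>] 0)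
      (𝓝 ((α + β - g) z + g x + 0 * (α + β - g) (x - z))) :=
    (Continuous.tendsto (by fun_prop) (0 : ℝ)).mono_left nhdsWithin_le_nhds
  have := le_of_tendsto hlim (eventually_of_mem (Ioo_mem_nhdsGT one_pos) hkey)
  simp only [sub_apply, add_apply, map_sub, zero_mul, add_zero] at this hακ
  linarith

end SetValued

open SetValued in
theorem corollary3p5 {X : Type*} [NormedAddCommGroup X] [NormedSpace ℝ X] [CompleteSpace X]
    (f : X → EReal) (hf_ne_bot : ∀ x, f x ≠ ⊥) (hf_proper : (SetValued.effDom f).Nonempty)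
    (hf_lsc : LowerSemicontinuous f) (hf_convex : SetValued.IsConvex f)
    (B : SetValued.Operator X) (hB : SetValued.IsMaximalMonotone B)
    (hfB : (SetValued.effDom f ∩ interior (SetValued.dom B)).Nonempty)
    (hdom : SetValued.dom (SetValued.subdifferential f) ∩ closure (SetValued.dom B) ⊆
      SetValued.dom B) :
    SetValued.IsMaximalMonotone (SetValued.sum (SetValued.subdifferential f) B) := by
  refine ⟨isMonotone_sum_subdifferential hf_ne_bot hf_proper hB.1, fun A hA hsub => ?_⟩
  refine (Subset.antisymm hsub ?_).symm
  rintro ⟨z, g⟩ hzg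
  have hrel : ∀ y, ∀ a ∈ subdifferential f y, ∀ b ∈ B y, 0 ≤ (g - (a + b)) (z - y) :=
    fun y a ha b hb => hA _ hzg (y, a + b) (hsub ⟨a, ha, b, hb, rfl⟩)
  have hle := fun x r s => le_of_monotonicallyRelated_sum hf_ne_bot hf_lsc hf_convex hB hfB hdom
    hrel (x := x) (r := r) (s := s)
  obtain ⟨x₀, ⟨r₀, hr₀⟩, hx₀⟩ := hfB
  obtain ⟨ε, hε, M, hM, hball, hbound⟩ := hB.1.exists_bound hx₀
  obtain ⟨K, hK⟩ := hB.1.exists_ball_fitzpatrickEpigraph hM hball hbound z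
  have hr₀' : (x₀, r₀) ∈ epigraph f := hr₀.le
  obtain ⟨φ, hφ⟩ : ∃ φ : ℝ, f z = φ := by
    refine ⟨(f z).toReal, (EReal.coe_toReal (fun htop => ?_) (hf_ne_bot z)).symm⟩
    have := hle x₀ r₀ K hr₀' (hK x₀ (Metric.mem_ball_self hε))
    rw [htop] at this
    exact EReal.coe_ne_top _ (top_le_iff.1 this)
  -- The epigraph of `x ↦ f x - f z - g (x - z)`.
  let P : Set (X × ℝ) := {p | (p.1, p.2 + φ + g (p.1 - z)) ∈ epigraph f}
  have hP : Convex ℝ P := by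
    rintro ⟨x, r⟩ hx ⟨y, s⟩ hy a b ha hb hab
    have := hf_convex.convex_epigraph hx hy ha hb hab
    obtain rfl : b = 1 - a := by linarith
    change (a • x + (1 - a) • y, _) ∈ epigraph f
    convert this using 1
    refine Prod.ext rfl ?_
    simp only [Prod.fst_add, Prod.smul_fst, Prod.snd_add, Prod.smul_snd, smul_eq_mul, map_sub,
      map_add, map_smul]
    ring
  have hcancel : ∀ r s : ℝ, r - φ - s + φ + s = r := fun r s => by ring
  have hnonneg : ∀ x r s, (x, r) ∈ P → (x, s) ∈ fitzpatrickEpigraph B z → 0 ≤ r + s := by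
    intro x r s hr hs
    have := hle x _ s hr hs
    rw [hφ, EReal.coe_le_coe_iff] at this
    linarith
  have hzP : (z, 0) ∈ P := by simpa [P, epigraph] using hφ.le
  have hx₀P : (x₀, r₀ - φ - g (x₀ - z)) ∈ P := by
    simpa only [P, mem_ofPred_eq, hcancel] using hr₀'
  obtain ⟨b, hb, hbP⟩ := hB.exists_mem_of_fitzpatrickEpigraph hP hzP hnonneg hε hx₀P hK
  refine ⟨g - b, mem_subdifferential_of_epigraph hf_ne_bot hφ fun p hp => ?_, b, hb, by simp⟩
  have := hbP p.1 (p.2 - φ - g (p.1 - z)) (by simpa only [P, mem_ofPred_eq, hcancel] using hp)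
  simp only [sub_apply]
  linarith
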